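/- Let $F$ be a field and $n\ge 0$. Let $ch(P_n)$ be the quadratic $F$-algebra presented by generators $v_1,\dots,v_n,e_{12},e_{23},\dots,e_{n-1,n}$ (one for each vertex and each edge of the $n$-vertex path) and relations $$[v_i,v_j]=0\ (j>i),\qquad [e_{i,i+1},e_{j,j+1}]=0\ (j>i+1),\qquad [v_i,e_{j,j+1}]=0\ (j\ge i+1\text{ or } j\le i-2).$$ Then the following hold. 1. $ch(P_n)$ is a PGC-algebra (each of its relations says that two generators commute). Its non-commuting graph, whose vertices are the generators and whose edges are the pairs of distinct generators that do not commute in $ch(P_n)$, has exactly the edges $\{v_i,e_{i,i+1}\}$ and $\{v_{i+1},e_{i,i+1}\}$ for $1\le i\le n-1$, and $\{e_{i,i+1},e_{i+1,i+2}\}$ for $1\le i\le n-2$. 2. The labelling $v_1<e_{12}<v_2<e_{23}<\cdots<e_{n-1,n}<v_n$ is a vertex ordering of this graph (a surjection from its $N$ vertices onto $N$ labels), and for all vertices $a,b,c$ such that $\{a,c\}$ is an edge while $\{a,b\}$ and $\{b,c\}$ are not edges, neither $a<b<c$ nor $c<b<a$ holds. 3. Ordering words first by length and then lexicographically with respect to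 this vertex ordering gives a monomial ordering. In the reduction system that the relations define with respect to it (each relation rewrites its largest word as a combination of smaller words), all ambiguities in the sense of the diamond lemma, in particular all those of degree three, are resolvable. 4. $ch(P_n)$ is Koszul: if $V$ is the span of the generators and $R\subset V\otimes V$ the span of the relations, then for every $m$ the subspaces $V^{\otimes i}\otimes R\otimes V^{\otimes j}$ with $i+2+j=m$ generate a distributive lattice of subspaces of $V^{\otimes m}$. -/

import Mathlib

universe u v

/-! ## Words, reduction systems and ambiguities in a free algebra -/

/-- The monomial of the free algebra given by a word in the generators. -/
noncomputable def wordMonomial (F : Type u) [Field F] {X : Type v} (w : FreeMonoid X) :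
    FreeAlgebra F X :=
  FreeMonoid.lift (FreeAlgebra.ι F) w

/-- The space spanned by the generators. -/
def generatorSpan (F : Type u) [Field F] (X : Type v) : Submodule F (FreeAlgebra F X) :=
  Submodule.span F (Set.range (FreeAlgebra.ι F : X → FreeAlgebra F X))

/-- The commutator of two generators, as an element of the free algebra. -/
noncomputable def genCommutator (F : Type u) [Field F] {X : Type v} (a b : X) :
    FreeAlgebra F X :=
  FreeAlgebra.ι F a * FreeAlgebra.ι F b - FreeAlgebra.ι F b * FreeAlgebra.ι F a

/-- A monomial ordering: a total well-ordering of the words that is compatible with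
multiplication on both sides. -/
structure IsMonomialOrder {X : Type v} (lt : FreeMonoid X → FreeMonoid X → Prop) : Prop where
  strictTotal : IsStrictTotalOrder (FreeMonoid X) lt
  wf : WellFounded lt
  mul_lt_mul : ∀ a b u w : FreeMonoid X, lt u w → lt (a * u * b) (a * w * b)

/-- Words are compared first by length, and words of the same length lexicographically, with
the generators ordered by their labels. -/
def degLex {X : Type v} {N : ℕ} (f : X → Fin N) (u w : FreeMonoid X) : Prop :=
  List.Shortlex (fun a b => f a < f b) u.toList w.toList

/-- A rewriting rule `W ⟶ g`, replacing the word `W` by the element `g` of the free algebra. -/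
abbrev Rule (F : Type u) [Field F] (X : Type v) := FreeMonoid X × FreeAlgebra F X

open Classical in
/-- The linear endomorphism of the free algebra which sends the word `A W B` to `A g B` and
fixes every other word, where `σ` is the rule `W ⟶ g`. -/
noncomputable def elementaryReduction {F : Type u} [Field F] {X : Type v}
    (A : FreeMonoid X) (σ : Rule F X) (B : FreeMonoid X) :
    FreeAlgebra F X →ₗ[F] FreeAlgebra F X :=
  (FreeAlgebra.basisFreeMonoid F X).constr F fun w =>
    if w = A * σ.1 * B then wordMonomial F A * σ.2 * wordMonomial F B else wordMonomial F w

/-- `y` is obtained from `x` by finitely many elementary reductions with rules of `S`. -/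
def ReducesTo {F : Type u} [Field F] {X : Type v} (S : Set (Rule F X))
    (x y : FreeAlgebra F X) : Prop :=
  Relation.ReflTransGen
    (fun p q => ∃ A B : FreeMonoid X, ∃ σ ∈ S, q = elementaryReduction A σ B p) x y

/-- Both elements can be reduced to a common element. -/
def HaveCommonReduct {F : Type u} [Field F] {X : Type v} (S : Set (Rule F X))
    (x y : FreeAlgebra F X) : Prop :=
  ∃ z, ReducesTo S x z ∧ ReducesTo S y z

/-- Every ambiguity of `S` whose word `A B C` has length `d` is resolvable: the overlap
ambiguities (`A B` and `B C` are the left sides of two rules, `A`, `B`, `C` nonempty), and the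
inclusion ambiguities (`B` and `A B C` are the left sides of two different rules). -/
structure AmbiguitiesResolve {F : Type u} [Field F] {X : Type v} (S : Set (Rule F X)) (d : ℕ) :
    Prop where
  overlap : ∀ A B C : FreeMonoid X, A ≠ 1 → B ≠ 1 → C ≠ 1 → (A * B * C).length = d →
    ∀ σ ∈ S, ∀ τ ∈ S, σ.1 = A * B → τ.1 = B * C →
      HaveCommonReduct S (σ.2 * wordMonomial F C) (wordMonomial F A * τ.2)
  inclusion : ∀ A B C : FreeMonoid X, (A * B * C).length = d →
    ∀ σ ∈ S, ∀ τ ∈ S, σ ≠ τ → σ.1 = B → τ.1 = A * B * C →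
      HaveCommonReduct S (wordMonomial F A * σ.2 * wordMonomial F C) τ.2

/-! ## Quadratic algebras -/

/-- A quadratic algebra, presented by the generators `X` and a set of relations that are
homogeneous of degree two. -/
structure QuadraticPresentation (F : Type u) [Field F] (X : Type v) where
  rels : Set (FreeAlgebra F X)
  rels_quadratic : ∀ r ∈ rels, r ∈ generatorSpan F X ^ 2

namespace QuadraticPresentation

variable {F : Type u} [Field F] {X : Type v}

/-- The presented algebra: the free algebra modulo the two-sided ideal generated by the
relations. -/
abbrev algebra (P : QuadraticPresentation F X) : Type (max u v) :=
  RingQuot (fun x y : FreeAlgebra F X => x ∈ P.rels ∧ y = 0)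

/-- The image of a generator in the presented algebra. -/
noncomputable def gen (P : QuadraticPresentation F X) (a : X) : P.algebra :=
  RingQuot.mkAlgHom F (fun x y : FreeAlgebra F X => x ∈ P.rels ∧ y = 0) (FreeAlgebra.ι F a)

/-- Each relation says that two generators commute. -/
def IsPGC (P : QuadraticPresentation F X) : Prop :=
  ∀ r ∈ P.rels, ∃ a b : X, r = genCommutator F a b

/-- Distinct generators are joined when they commute in the presented algebra. -/
def commutingGraph (P : QuadraticPresentation F X) : SimpleGraph X where
  Adj a b := a ≠ b ∧ P.gen a * P.gen b = P.gen b * P.gen a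
  symm := ⟨fun _ _ h => ⟨h.1.symm, h.2.symm⟩⟩
  loopless := ⟨fun _ h => h.1 rfl⟩

/-- The complement of the commuting graph. -/
def nonCommutingGraph (P : QuadraticPresentation F X) : SimpleGraph X :=
  P.commutingGraphᶜ

/-- The rules obtained from the relations: each relation is rescaled so that its largest word
`W` has coefficient one, say to `W - g` with `g` a combination of smaller words, and gives
the rule `W ⟶ g`. -/
def reductions (P : QuadraticPresentation F X) (lt : FreeMonoid X → FreeMonoid X → Prop) :
    Set (Rule F X) :=
  {σ | ∃ r ∈ P.rels, ∃ c : F, c ≠ 0 ∧ wordMonomial F σ.1 - σ.2 = c • r ∧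
    σ.2 ∈ Submodule.span F (wordMonomial F '' {w | lt w σ.1})}

/-- The space spanned by the relations, a subspace of `V ⊗ V`. -/
def relSpan (P : QuadraticPresentation F X) : Submodule F (FreeAlgebra F X) :=
  Submodule.span F P.rels

/-- The subspaces `V^{⊗ i} ⊗ R ⊗ V^{⊗ j}` of `V^{⊗ N}`, where `i + 2 + j = N`. Here `V` is the
span of the generators, and the tensor algebra of `V` is the free algebra, so that `V^{⊗ N}` is
the `N`-th power of `V` there and a tensor product of subspaces is the product of subspaces. -/
def koszulSubspaces (P : QuadraticPresentation F X) (N : ℕ) :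
    Set (Submodule F (FreeAlgebra F X)) :=
  {W | ∃ i j : ℕ, i + 2 + j = N ∧
    W = generatorSpan F X ^ i * P.relSpan * generatorSpan F X ^ j}

/-- The quadratic algebra is Koszul: for every `N`, the subspaces
`V^{⊗ i} ⊗ R ⊗ V^{⊗ j}` with `i + 2 + j = N` generate a distributive lattice of subspaces. -/
def IsKoszul (P : QuadraticPresentation F X) : Prop :=
  ∀ N : ℕ, ∀ x ∈ latticeClosure (P.koszulSubspaces N),
    ∀ y ∈ latticeClosure (P.koszulSubspaces N),
      ∀ z ∈ latticeClosure (P.koszulSubspaces N), x ⊓ (y ⊔ z) = (x ⊓ y) ⊔ (x ⊓ z)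

end QuadraticPresentation

/-! ## Vertex orderings -/

/-- A vertex ordering of a graph with `N` vertices: a surjection from the vertices onto `N`
labels. -/
def IsVertexOrdering {X : Type v} [Fintype X] {N : ℕ} (f : X → Fin N) : Prop :=
  Fintype.card X = N ∧ Function.Surjective f

/-- For all vertices `a`, `b`, `c` such that `a`, `c` are joined and `b` is joined to neither of
them, the label of `b` does not lie between those of `a` and `c`. -/
def OrderingCondition {X : Type v} {N : ℕ} (G : SimpleGraph X) (f : X → Fin N) : Prop :=
  ∀ a b c : X, G.Adj a c → ¬ G.Adj a b → ¬ G.Adj b c →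
    ¬ (f a < f b ∧ f b < f c) ∧ ¬ (f c < f b ∧ f b < f a)

/-! ## The algebra `ch(P_n)` -/

/-- The vertices and the edges of the path with `n` vertices. The indices start from zero, and
the edge with index `i` joins the vertices with indices `i` and `i + 1`. -/
abbrev PathGen (n : ℕ) := Fin n ⊕ Fin (n - 1)

namespace PathGen

/-- The generator of the vertex with index `i`. -/
abbrev v {n : ℕ} (i : Fin n) : PathGen n := Sum.inl i

/-- The generator of the edge that joins the vertices with indices `i` and `i + 1`. -/
abbrev e {n : ℕ} (i : Fin (n - 1)) : PathGen n := Sum.inr i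

end PathGen

open PathGen in
/-- The pairs of generators whose commutators are the relations of `ch(P_n)`. -/
inductive ChPair (n : ℕ) : PathGen n → PathGen n → Prop
  | vv (i j : Fin n) (h : (i : ℕ) + 1 < j) : ChPair n (v i) (v j)
  | vv_succ (i j : Fin n) (h : (j : ℕ) = i + 1) : ChPair n (v i) (v j)
  | ee (i j : Fin (n - 1)) (h : (i : ℕ) + 1 < j) : ChPair n (e i) (e j)
  | ve (i : Fin n) (j : Fin (n - 1)) (h : (i : ℕ) + 1 < j ∨ (j : ℕ) + 2 < i) :
      ChPair n (v i) (e j)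
  | ve_right (i : Fin n) (j : Fin (n - 1)) (h : (j : ℕ) = i + 1) : ChPair n (v i) (e j)
  | ve_left (i : Fin n) (j : Fin (n - 1)) (h : (i : ℕ) = j + 2) : ChPair n (v i) (e j)

theorem genCommutator_mem (F : Type u) [Field F] {X : Type v} (a b : X) :
    genCommutator F a b ∈ generatorSpan F X ^ 2 := by
  have h : ∀ x : X, FreeAlgebra.ι F x ∈ generatorSpan F X := fun x =>
    Submodule.subset_span ⟨x, rfl⟩
  rw [pow_two]
  exact Submodule.sub_mem _ (Submodule.mul_mem_mul (h a) (h b)) (Submodule.mul_mem_mul (h b) (h a))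

/-- The algebra `ch(P_n)`, as a quadratic algebra. -/
def chP (F : Type u) [Field F] (n : ℕ) : QuadraticPresentation F (PathGen n) where
  rels := {r | ∃ a b : PathGen n, ChPair n a b ∧ r = genCommutator F a b}
  rels_quadratic := by
    rintro r ⟨a, b, -, rfl⟩
    exact genCommutator_mem F a b

open PathGen in
/-- An edge of the path is related to its two end points and to the next edge. -/
inductive PathIncident (n : ℕ) : PathGen n → PathGen n → Prop
  | left (i : Fin n) (j : Fin (n - 1)) (h : (i : ℕ) = j) : PathIncident n (v i) (e j)
  | right (i : Fin n) (j : Fin (n - 1)) (h : (i : ℕ) = j + 1) : PathIncident n (v i) (e j)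
  | next (i j : Fin (n - 1)) (h : (j : ℕ) = i + 1) : PathIncident n (e i) (e j)

/-- The graph on the vertices and the edges of the path in which every edge is joined to its
two end points and to the adjacent edges. -/
def pathNonCommutingGraph (n : ℕ) : SimpleGraph (PathGen n) :=
  SimpleGraph.fromRel (PathIncident n)

/-- The labelling by position along the path: vertex, edge, vertex, edge, and so on. -/
def pathLabel (n : ℕ) : PathGen n → Fin (2 * n - 1)
  | Sum.inl i => ⟨2 * i, by omega⟩
  | Sum.inr i => ⟨2 * i + 1, by omega⟩

/-! ## Distributing bases -/

/-! Orient each commuting pair from the larger label to the smaller. The ordering condition says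
exactly what makes this relation `R` transitive: if `a`, `b` and `b`, `c` commute with labels
descending, then `a` and `c` commute as well. Everything but the graph and the ordering itself rests
on this. The only ambiguities are the overlaps `abc` with `R a b` and `R b c`. As `R a c` also
holds, both sides can be sorted to `cba`. For Koszulness, fix the word length and cut each word into
its maximal `R`-descending runs. By transitivity any two letters of a run commute. The signed sum
over rearrangements within the runs has the word itself as its largest term, with coefficient one,
so these sums are linearly independent over every field (`linearIndependent_antisymmetrized`). Each
subspace `V^i R V^j` is spanned by the sums of the words with a descent at the matching position
(`span_sub_swap_eq_span_antisymmetrized`). Subspaces spanned by parts of one independent family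
generate a distributive lattice. Generators without a relation fail to commute because they can be
mapped to opposite matrix units. -/

theorem span_image_inter_of_linearIndependent {F M ι : Type*} [Field F] [AddCommGroup M]
    [Module F M] {b : ι → M} (hb : LinearIndependent F b) (S T : Set ι) :
    Submodule.span F (b '' (S ∩ T)) = Submodule.span F (b '' S) ⊓ Submodule.span F (b '' T) := by
  simp only [Finsupp.span_image_eq_map_linearCombination, Finsupp.supported_inter]
  -- Independence is injectivity of `Finsupp.linearCombination`, and images under an injective map
  -- respect intersections.
  exact Submodule.map_inf _ (by simpa [LinearIndependent] using hb)

/-- Subspaces spanned by parts of one linearly independent family generate a distributive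
lattice. -/
theorem inf_sup_of_mem_latticeClosure {F M ι : Type*} [Field F] [AddCommGroup M]
    [Module F M] {b : ι → M} (hb : LinearIndependent F b) {𝒲 : Set (Submodule F M)}
    (h𝒲 : ∀ W ∈ 𝒲, ∃ S : Set ι, W = Submodule.span F (b '' S))
    {x y z : Submodule F M} (hx : x ∈ latticeClosure 𝒲) (hy : y ∈ latticeClosure 𝒲)
    (hz : z ∈ latticeClosure 𝒲) : x ⊓ (y ⊔ z) = (x ⊓ y) ⊔ (x ⊓ z) := by
  -- Spans of subfamilies are closed under sums and intersections, so distributivity is inherited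
  -- from the subsets of `ι`.
  have hle : latticeClosure 𝒲 ⊆ Set.range fun S : Set ι => Submodule.span F (b '' S) := by
    refine latticeClosure_min (fun W hW => (h𝒲 W hW).imp fun S hS => hS.symm) ⟨?_, ?_⟩
    · rintro _ ⟨S, rfl⟩ _ ⟨T, rfl⟩
      exact ⟨S ∪ T, by simp [Set.image_union, Submodule.span_union]⟩
    · rintro _ ⟨S, rfl⟩ _ ⟨T, rfl⟩
      exact ⟨S ∩ T, span_image_inter_of_linearIndependent hb S T⟩
  obtain ⟨S, rfl⟩ := hle hx
  obtain ⟨T, rfl⟩ := hle hy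
  obtain ⟨U, rfl⟩ := hle hz
  simp only [← Submodule.span_union, ← Set.image_union,
    ← span_image_inter_of_linearIndependent hb, Set.inter_union_distrib_left]

/-- A family that is unitriangular over a linearly independent family is linearly independent. -/
theorem linearIndependent_of_unitriangular {F M ι L : Type*} [Field F] [AddCommGroup M]
    [Module F M] [LinearOrder L] {m b : ι → M} (hm : LinearIndependent F m) {rank : ι → L}
    (hrank : Function.Injective rank)
    (hb : ∀ w, b w - m w ∈ Submodule.span F (m '' {w' | rank w' < rank w})) :
    LinearIndependent F b := by
  classical
  rw [linearIndependent_iff]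
  intro l hl
  by_contra hne
  -- In a nontrivial relation, the term of largest rank would put `m w` in the span of members of
  -- smaller rank.
  obtain ⟨w, hw, hmax⟩ := l.support.exists_max_image rank (Finsupp.support_nonempty_iff.2 hne)
  refine hm.notMem_span_image (s := {w' | rank w' < rank w}) (x := w) (by simp) ?_
  have hsum : l w • m w = -(l w • (b w - m w)) - ∑ w' ∈ l.support.erase w, l w' • b w' := by
    rw [Finsupp.linearCombination_apply, Finsupp.sum, ← Finset.add_sum_erase _ _ hw] at hl
    rw [smul_sub, eq_neg_of_add_eq_zero_left hl]
    abel
  have hmem : l w • m w ∈ Submodule.span F (m '' {w' | rank w' < rank w}) := by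
    rw [hsum]
    refine sub_mem (neg_mem (Submodule.smul_mem _ _ (hb w))) (sum_mem fun w' hw' => ?_)
    rw [Finset.mem_erase] at hw'
    have hlt : rank w' < rank w :=
      lt_of_le_of_ne (hmax w' hw'.2) fun h => hw'.1 (hrank h)
    rw [← sub_add_cancel (b w') (m w')]
    refine Submodule.smul_mem _ _ (add_mem (Submodule.span_mono (Set.image_mono ?_) (hb w'))
      (Submodule.subset_span ⟨w', hlt, rfl⟩))
    exact fun w'' h => lt_trans h hlt
  exact (Submodule.smul_mem_iff _ (Finsupp.mem_support_iff.1 hw)).1 hmem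

/-! ## Antisymmetrization of a word over its descending runs -/

section Antisymmetrization

variable {X : Type*} (R : X → X → Prop) {N : ℕ}

/-- The letters of `w` at the positions `t` and `t + 1` are related. -/
def DescentAt (w : Fin N → X) (t : ℕ) : Prop :=
  ∃ h : t + 1 < N, R (w ⟨t, by omega⟩) (w ⟨t + 1, h⟩)

/-- All positions between `p` and `q` are descents. -/
def SameRun (w : Fin N → X) (p q : Fin N) : Prop :=
  ∀ t : ℕ, (p : ℕ) ≤ t ∧ t < q ∨ (q : ℕ) ≤ t ∧ t < p → DescentAt R w t

open Classical in
/-- The permutations of the positions that preserve the descending runs of `w`. -/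
noncomputable def runPerms (w : Fin N → X) : Finset (Equiv.Perm (Fin N)) :=
  {u | ∀ k, SameRun R w k (u k)}

/-- The alternating sum over the rearrangements of `w` within its descending runs. -/
noncomputable def antisymmetrized {M : Type*} [AddCommGroup M] (m : (Fin N → X) → M)
    (w : Fin N → X) : M :=
  ∑ u ∈ runPerms R w, (Equiv.Perm.sign u : ℤ) • m (w ∘ u)

variable {R}

theorem mem_runPerms {w : Fin N → X} {u : Equiv.Perm (Fin N)} :
    u ∈ runPerms R w ↔ ∀ k, SameRun R w k (u k) := by
  simp [runPerms]

theorem SameRun.symm {w : Fin N → X} {p q : Fin N} (h : SameRun R w p q) : SameRun R w q p :=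
  fun t ht => h t ht.symm

theorem SameRun.trans {w : Fin N → X} {p q r : Fin N} (h : SameRun R w p q)
    (h' : SameRun R w q r) : SameRun R w p r := fun t ht => by
  by_cases hpq : (p : ℕ) ≤ t ∧ t < q ∨ (q : ℕ) ≤ t ∧ t < p
  · exact h t hpq
  · exact h' t (by omega)

/-- Transitivity turns a chain of adjacent descents into a relation between its two ends. -/
theorem SameRun.rel (hR : ∀ a b c, R a b → R b c → R a c) {w : Fin N → X} {p q : Fin N}
    (hpq : p < q) (h : SameRun R w p q) : R (w p) (w q) := by
  obtain ⟨p, hp⟩ := p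
  obtain ⟨q, hq⟩ := q
  have hlt : p < q := hpq
  clear hpq
  induction q, hlt using Nat.le_induction with
  | base => exact (h p (Or.inl ⟨le_rfl, Nat.lt_succ_self p⟩)).2
  | succ q hle ih =>
    refine hR _ _ _ (ih (by omega) (fun t ht => h t ?_))
      (h q (Or.inl ⟨by simp; omega, Nat.lt_succ_self q⟩)).2
    simp only at ht ⊢
    omega

theorem one_mem_runPerms (w : Fin N → X) : 1 ∈ runPerms R w :=
  mem_runPerms.2 fun k t ht => by simp at ht; omega

theorem mul_swap_mem_runPerms {w : Fin N → X} {u : Equiv.Perm (Fin N)} (hu : u ∈ runPerms R w)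
    {p q : Fin N} (hpq : SameRun R w p q) : u * Equiv.swap p q ∈ runPerms R w := by
  rw [mem_runPerms] at hu ⊢
  intro k
  refine SameRun.trans ?_ (hu (Equiv.swap p q k))
  rcases eq_or_ne k p with rfl | hp
  · simpa using hpq
  rcases eq_or_ne k q with rfl | hq
  · simpa using hpq.symm
  · rw [Equiv.swap_apply_of_ne_of_ne hp hq]
    exact fun t ht => by omega

/-- Right multiplication by `Equiv.swap p q` is a sign-reversing involution of `runPerms R w`, and
it exchanges the permutations with `u p < u q` and the others. -/
theorem antisymmetrized_eq_sum_sub {M : Type*} [AddCommGroup M] (m : (Fin N → X) → M)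
    {w : Fin N → X} {p q : Fin N} (hne : p ≠ q) (hpq : SameRun R w p q) :
    antisymmetrized R m w = ∑ u ∈ runPerms R w with u p < u q,
      (Equiv.Perm.sign u : ℤ) • (m (w ∘ u) - m ((w ∘ u) ∘ Equiv.swap p q)) := by
  rw [antisymmetrized, ← Finset.sum_filter_add_sum_filter_not _ fun u => u p < u q]
  simp only [smul_sub]
  rw [Finset.sum_sub_distrib, sub_eq_add_neg, ← Finset.sum_neg_distrib]
  congr 1
  refine Finset.sum_bij' (fun u _ => u * Equiv.swap p q) (fun u _ => u * Equiv.swap p q)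
    ?_ ?_ ?_ ?_ ?_
  · intro u hu
    rw [Finset.mem_filter] at hu ⊢
    refine ⟨mul_swap_mem_runPerms hu.1 hpq, ?_⟩
    simpa using lt_of_le_of_ne (not_lt.1 hu.2) fun h => hne (u.injective h).symm
  · intro u hu
    rw [Finset.mem_filter] at hu ⊢
    exact ⟨mul_swap_mem_runPerms hu.1 hpq, by simpa using hu.2.le⟩
  · intro u _
    simp [mul_assoc]
  · intro u _
    simp [mul_assoc]
  · intro u _
    rw [Equiv.Perm.sign_mul, Equiv.Perm.sign_swap hne]
    have : (w ∘ (u * Equiv.swap p q : Equiv.Perm (Fin N))) ∘ Equiv.swap p q = w ∘ u := by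
      funext k
      simp
    rw [this]
    simp

variable {α : Type*} [LinearOrder α] {f : X → α}

/-- At the first position moved by `u`, all earlier positions being fixed, the new letter comes from
further right in the same run and so has a smaller label. -/
theorem toLex_comp_lt_of_mem_runPerms (hR : ∀ a b c, R a b → R b c → R a c)
    (hRf : ∀ a b, R a b → f b < f a) {w : Fin N → X} {u : Equiv.Perm (Fin N)}
    (hu : u ∈ runPerms R w) (hne : u ≠ 1) :
    toLex (f ∘ (w ∘ u)) < toLex (f ∘ w) := by
  have hex : ∃ k : Fin N, u k ≠ k := by
    by_contra h
    push Not at h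
    exact hne (Equiv.ext h)
  obtain ⟨p, hp, hmin⟩ := WellFounded.has_min (wellFounded_lt (α := Fin N)) {k | u k ≠ k} hex
  have hfix : ∀ k < p, u k = k := fun k hk => by
    by_contra h
    exact hmin k h hk
  have hlt : p < u p := by
    refine lt_of_le_of_ne (not_lt.1 fun h => hp ?_) (Ne.symm hp)
    exact u.injective (hfix _ h)
  refine ⟨p, fun k hk => ?_, ?_⟩
  · simp [hfix k hk]
  · exact hRf _ _ ((mem_runPerms.1 hu p).rel hR hlt)

variable {F M : Type*} [Field F] [AddCommGroup M] [Module F M] {m : (Fin N → X) → M}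

theorem antisymmetrized_sub_self_mem (hR : ∀ a b c, R a b → R b c → R a c)
    (hRf : ∀ a b, R a b → f b < f a) (w : Fin N → X) :
    antisymmetrized R m w - m w ∈
      Submodule.span F (m '' {w' | toLex (f ∘ w') < toLex (f ∘ w)}) := by
  rw [antisymmetrized, ← Finset.add_sum_erase _ _ (one_mem_runPerms w)]
  simp only [Equiv.Perm.sign_one, Units.val_one, one_smul, Equiv.Perm.coe_one, Function.comp_id,
    add_sub_cancel_left]
  refine sum_mem fun u hu => zsmul_mem ?_ _
  rw [Finset.mem_erase] at hu
  exact Submodule.subset_span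
    ⟨w ∘ u, toLex_comp_lt_of_mem_runPerms hR hRf hu.2 hu.1, rfl⟩

theorem linearIndependent_antisymmetrized (hR : ∀ a b c, R a b → R b c → R a c)
    (hRf : ∀ a b, R a b → f b < f a) (hf : Function.Injective f) (hm : LinearIndependent F m) :
    LinearIndependent F (antisymmetrized R m) :=
  linearIndependent_of_unitriangular hm (rank := fun w => toLex (f ∘ w))
    (fun _ _ h => hf.comp_left (toLex.injective h)) (antisymmetrized_sub_self_mem hR hRf)

/-- The antisymmetrized words with a descent at the position of `p` are a basis of the space
spanned by the commutators at that position. -/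
theorem span_sub_swap_eq_span_antisymmetrized [WellFoundedLT α]
    (hR : ∀ a b c, R a b → R b c → R a c) (hRf : ∀ a b, R a b → f b < f a)
    {p q : Fin N} (hpq : (q : ℕ) = p + 1) :
    Submodule.span F {x | ∃ w : Fin N → X, R (w p) (w q) ∧ x = m w - m (w ∘ Equiv.swap p q)} =
      Submodule.span F (antisymmetrized R m '' {w | R (w p) (w q)}) := by
  have hlt : p < q := by rw [Fin.lt_def]; omega
  have hrun : ∀ w : Fin N → X, R (w p) (w q) → SameRun R w p q := by
    intro w hw t ht
    obtain rfl : t = p := by omega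
    have hq : q = ⟨p + 1, by omega⟩ := Fin.ext hpq
    exact ⟨by omega, hq ▸ hw⟩
  -- The positions `u p` and `u q` lie in the common run of `p` and `q`, so a rearrangement with `u
  -- p < u q` still has a descent there.
  have hdesc : ∀ w : Fin N → X, R (w p) (w q) → ∀ u ∈ runPerms R w, u p < u q →
      R ((w ∘ u) p) ((w ∘ u) q) := fun w hw u hu hlt' =>
    SameRun.rel (w := w) (p := u p) (q := u q) hR hlt' (((mem_runPerms.1 hu p).symm.trans (hrun w hw)).trans
      (mem_runPerms.1 hu q))
  apply le_antisymm
  · rw [Submodule.span_le]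
    rintro _ ⟨w, hw, rfl⟩
    -- In the paired sum for `w`, the identity gives the commutator at `w`; the other terms are
    -- commutators at lexicographically smaller words, covered by induction.
    induction w using (InvImage.wf (fun w : Fin N → X => toLex (f ∘ w))
      (wellFounded_lt (α := Lex (Fin N → α)))).induction with
    | _ w ih =>
      have hsum := antisymmetrized_eq_sum_sub m hlt.ne (hrun w hw)
      have hone : (1 : Equiv.Perm (Fin N)) ∈ {u ∈ runPerms R w | u p < u q} := by
        simpa using ⟨one_mem_runPerms w, hlt⟩
      rw [← Finset.add_sum_erase _ _ hone, ← sub_eq_iff_eq_add] at hsum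
      simp only [Equiv.Perm.sign_one, Units.val_one, one_smul, Equiv.Perm.coe_one,
        Function.comp_id] at hsum
      rw [← hsum]
      refine sub_mem (Submodule.subset_span ⟨w, hw, rfl⟩) (sum_mem fun u hu => zsmul_mem ?_ _)
      simp only [Finset.mem_erase, Finset.mem_filter] at hu
      exact ih (w ∘ u) (toLex_comp_lt_of_mem_runPerms hR hRf hu.2.1 hu.1)
        (hdesc w hw u hu.2.1 hu.2.2)
  · rw [Submodule.span_le]
    rintro _ ⟨w, hw, rfl⟩
    rw [antisymmetrized_eq_sum_sub m hlt.ne (hrun w hw)]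
    refine sum_mem fun u hu => zsmul_mem ?_ _
    rw [Finset.mem_filter] at hu
    exact Submodule.subset_span ⟨w ∘ u, hdesc w hw u hu.1 hu.2, rfl⟩

end Antisymmetrization

/-! ## Monomials of words -/

section Words

variable (F : Type u) [Field F] {X : Type v}

@[simp]
theorem wordMonomial_mul (w w' : FreeMonoid X) :
    wordMonomial F (w * w') = wordMonomial F w * wordMonomial F w' := map_mul _ _ _

@[simp]
theorem wordMonomial_of (a : X) : wordMonomial F (FreeMonoid.of a) = FreeAlgebra.ι F a :=
  FreeMonoid.lift_eval_of _ _

theorem basisFreeMonoid_apply (w : FreeMonoid X) :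
    FreeAlgebra.basisFreeMonoid F X w = wordMonomial F w := by
  simp [FreeAlgebra.basisFreeMonoid, FreeAlgebra.equivMonoidAlgebraFreeMonoid, wordMonomial,
    MonoidAlgebra.lift_single]

theorem linearIndependent_wordMonomial :
    LinearIndependent F (wordMonomial F : FreeMonoid X → FreeAlgebra F X) := by
  have h := (FreeAlgebra.basisFreeMonoid F X).linearIndependent
  rwa [show ⇑(FreeAlgebra.basisFreeMonoid F X) = wordMonomial F from
    funext (basisFreeMonoid_apply F)] at h

/-- The monomial of a word given by its letters. -/
noncomputable def ofFnMonomial {N : ℕ} (w : Fin N → X) : FreeAlgebra F X :=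
  wordMonomial F (FreeMonoid.ofList (List.ofFn w))

theorem ofFnMonomial_eq_prod {N : ℕ} (w : Fin N → X) :
    ofFnMonomial F w = (List.ofFn fun k => FreeAlgebra.ι F (w k)).prod := by
  rw [ofFnMonomial, wordMonomial, FreeMonoid.lift_apply, FreeMonoid.toList_ofList, List.map_ofFn]
  rfl

theorem ofFnMonomial_append {i j : ℕ} (p : Fin i → X) (q : Fin j → X) :
    ofFnMonomial F (Fin.append p q) = ofFnMonomial F p * ofFnMonomial F q := by
  rw [ofFnMonomial, List.ofFn_fin_append, FreeMonoid.ofList_append, wordMonomial_mul]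
  rfl

theorem ofFnMonomial_pair (a b : X) :
    ofFnMonomial F ![a, b] = FreeAlgebra.ι F a * FreeAlgebra.ι F b := by
  simp [ofFnMonomial_eq_prod]

theorem linearIndependent_ofFnMonomial (N : ℕ) :
    LinearIndependent F (ofFnMonomial F : (Fin N → X) → FreeAlgebra F X) :=
  (linearIndependent_wordMonomial F).comp (fun w => FreeMonoid.ofList (List.ofFn w))
    fun _ _ h => List.ofFn_injective (FreeMonoid.ofList.injective h)

theorem generatorSpan_pow (i : ℕ) :
    generatorSpan F X ^ i =
      Submodule.span F (Set.range (ofFnMonomial F : (Fin i → X) → FreeAlgebra F X)) := by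
  rw [generatorSpan, Submodule.span_pow]
  congr 1
  ext x
  rw [Set.mem_pow]
  constructor
  · rintro ⟨g, rfl⟩
    choose w hw using fun k => (g k).2
    exact ⟨w, by simp [ofFnMonomial_eq_prod, hw]⟩
  · rintro ⟨w, rfl⟩
    exact ⟨fun k => ⟨_, w k, rfl⟩, (ofFnMonomial_eq_prod F w).symm⟩

end Words

/-! ## Koszulness -/

section Koszul

variable {F : Type u} [Field F] {X : Type v}

theorem append_pair_comp_swap {i j : ℕ} (p : Fin i → X) (a b : X) (q : Fin j → X) :
    Fin.append (Fin.append p ![a, b]) q ∘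
      Equiv.swap (Fin.castAdd j (Fin.natAdd i 0)) (Fin.castAdd j (Fin.natAdd i 1)) =
    Fin.append (Fin.append p ![b, a]) q := by
  funext k
  rw [Function.comp_apply]
  induction k using Fin.addCases with
  | left k =>
    induction k using Fin.addCases with
    | left k =>
      rw [Equiv.swap_apply_of_ne_of_ne (by rw [Ne, Fin.ext_iff]; simp; omega)
        (by rw [Ne, Fin.ext_iff]; simp; omega)]
      simp
    | right k =>
      revert k
      rw [Fin.forall_fin_two]
      simp
  | right k =>
    rw [Equiv.swap_apply_of_ne_of_ne (by rw [Ne, Fin.ext_iff]; simp; omega)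
      (by rw [Ne, Fin.ext_iff]; simp; omega)]
    simp

/-- Expanding the outer factors into words turns the product into commutators at two adjacent
positions of a word, the form required by `span_sub_swap_eq_span_antisymmetrized`. -/
theorem pow_mul_span_commutators_mul_pow (R : X → X → Prop) (i j : ℕ) :
    generatorSpan F X ^ i * Submodule.span F {r | ∃ a b, R a b ∧ r = genCommutator F a b} *
      generatorSpan F X ^ j =
    Submodule.span F {x | ∃ w : Fin (i + 2 + j) → X,
      R (w (Fin.castAdd j (Fin.natAdd i 0))) (w (Fin.castAdd j (Fin.natAdd i 1))) ∧
      x = ofFnMonomial F w - ofFnMonomial F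
        (w ∘ Equiv.swap (Fin.castAdd j (Fin.natAdd i 0)) (Fin.castAdd j (Fin.natAdd i 1)))} := by
  have key : ∀ (p : Fin i → X) (a b : X) (q : Fin j → X),
      ofFnMonomial F p * genCommutator F a b * ofFnMonomial F q =
      ofFnMonomial F (Fin.append (Fin.append p ![a, b]) q) -
        ofFnMonomial F (Fin.append (Fin.append p ![b, a]) q) := fun p a b q => by
    simp only [ofFnMonomial_append, ofFnMonomial_pair, genCommutator, mul_sub, sub_mul]
  rw [generatorSpan_pow, generatorSpan_pow, Submodule.span_mul_span, Submodule.span_mul_span]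
  congr 1
  ext x
  constructor
  · rintro ⟨_, ⟨_, ⟨p, rfl⟩, _, ⟨a, b, hab, rfl⟩, rfl⟩, _, ⟨q, rfl⟩, rfl⟩
    refine ⟨Fin.append (Fin.append p ![a, b]) q, by simpa using hab, ?_⟩
    rw [append_pair_comp_swap]
    exact key p a b q
  · rintro ⟨w, hw, rfl⟩
    obtain ⟨p, a, b, q, rfl⟩ : ∃ p a b q, w = Fin.append (Fin.append p ![a, b]) q := by
      refine ⟨fun k => w (Fin.castAdd j (Fin.castAdd 2 k)),
        w (Fin.castAdd j (Fin.natAdd i 0)), w (Fin.castAdd j (Fin.natAdd i 1)),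
        fun k => w (Fin.natAdd _ k), ?_⟩
      funext k
      induction k using Fin.addCases with
      | left k =>
        induction k using Fin.addCases with
        | left k => simp
        | right k =>
          revert k
          rw [Fin.forall_fin_two]
          simp
      | right k => simp
    rw [append_pair_comp_swap, ← key]
    refine Set.mul_mem_mul (Set.mul_mem_mul ⟨p, rfl⟩ ⟨a, b, ?_, rfl⟩) ⟨q, rfl⟩
    simpa using hw

/-- An algebra whose relations say that the pairs of generators in a strict partial order
commute is Koszul. -/
theorem QuadraticPresentation.isKoszul_of_relSpan_eq {α : Type*} [LinearOrder α]
    [WellFoundedLT α] {f : X → α} (hf : Function.Injective f) {R : X → X → Prop}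
    (hR : ∀ a b c, R a b → R b c → R a c) (hRf : ∀ a b, R a b → f b < f a)
    {P : QuadraticPresentation F X}
    (hP : P.relSpan = Submodule.span F {r | ∃ a b, R a b ∧ r = genCommutator F a b}) :
    P.IsKoszul := by
  intro N x hx y hy z hz
  -- This family depends on `N` only, not on `i` and `j`, so it serves all the subspaces at once.
  refine inf_sup_of_mem_latticeClosure (b := antisymmetrized R (ofFnMonomial F (N := N)))
    (linearIndependent_antisymmetrized hR hRf hf (linearIndependent_ofFnMonomial F N))
    ?_ hx hy hz
  rintro _ ⟨i, j, rfl, rfl⟩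
  rw [hP, pow_mul_span_commutators_mul_pow]
  exact ⟨_, span_sub_swap_eq_span_antisymmetrized hR hRf (by simp)⟩

end Koszul

/-! ## Algebras presented by commutators of generators -/

section Commutators

variable {F : Type u} [Field F] {X : Type v} {C : X → X → Prop} {P : QuadraticPresentation F X}

theorem genCommutator_swap (a b : X) : genCommutator F b a = -genCommutator F a b :=
  (neg_sub _ _).symm

theorem relSpan_eq_span_descending {α : Type*} [LinearOrder α] {f : X → α}
    (hP : P.rels = {r | ∃ a b, C a b ∧ r = genCommutator F a b})
    (hC : ∀ a b, C a b → f a ≠ f b) :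
    P.relSpan = Submodule.span F
      {r | ∃ a b, ((C a b ∨ C b a) ∧ f b < f a) ∧ r = genCommutator F a b} := by
  rw [QuadraticPresentation.relSpan, hP]
  apply le_antisymm <;> rw [Submodule.span_le]
  · rintro _ ⟨a, b, hab, rfl⟩
    rcases lt_or_gt_of_ne (hC a b hab) with h | h
    · rw [genCommutator_swap]
      exact neg_mem (Submodule.subset_span ⟨b, a, ⟨Or.inr hab, h⟩, rfl⟩)
    · exact Submodule.subset_span ⟨a, b, ⟨Or.inl hab, h⟩, rfl⟩
  · rintro _ ⟨a, b, ⟨hab | hba, -⟩, rfl⟩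
    · exact Submodule.subset_span ⟨a, b, hab, rfl⟩
    · rw [genCommutator_swap]
      exact neg_mem (Submodule.subset_span ⟨b, a, hba, rfl⟩)

theorem gen_mul_gen_comm (hP : P.rels = {r | ∃ a b, C a b ∧ r = genCommutator F a b})
    {a b : X} (h : C a b) : P.gen a * P.gen b = P.gen b * P.gen a := by
  have h0 := RingQuot.mkAlgHom_rel F
    (s := fun x y : FreeAlgebra F X => x ∈ P.rels ∧ y = 0) (x := genCommutator F a b) (y := 0)
    ⟨by rw [hP]; exact ⟨a, b, h, rfl⟩, rfl⟩
  rw [genCommutator, map_sub, map_mul, map_mul, map_zero, sub_eq_zero] at h0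
  exact h0

/-- Two generators whose commutator is not a relation do not commute: a quotient of the algebra
is generated by a pair of opposite matrix units. -/
theorem gen_mul_gen_ne (hP : P.rels = {r | ∃ a b, C a b ∧ r = genCommutator F a b})
    {a b : X} (hne : a ≠ b) (hab : ¬ C a b) (hba : ¬ C b a) :
    P.gen a * P.gen b ≠ P.gen b * P.gen a := by
  classical
  let g : X → Matrix (Fin 2) (Fin 2) F := fun c =>
    if c = a then !![0, 1; 0, 0] else if c = b then !![0, 0; 1, 0] else 0
  -- Only the images of `a` and `b` fail to commute with each other, and neither order of that pair
  -- is a relation.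
  have hg : ∀ c d, C c d → g c * g d = g d * g c := by
    intro c d hcd
    by_cases hca : c = a <;> by_cases hcb : c = b <;> by_cases hda : d = a <;>
      by_cases hdb : d = b <;> simp_all [g]
  have hrel : ∀ ⦃x y : FreeAlgebra F X⦄, x ∈ P.rels ∧ y = 0 →
      FreeAlgebra.lift F g x = FreeAlgebra.lift F g y := by
    rintro x y ⟨hx, rfl⟩
    rw [hP] at hx
    obtain ⟨c, d, hcd, rfl⟩ := hx
    simp [genCommutator, hg c d hcd]
  intro h
  have hφ : ∀ c, RingQuot.liftAlgHom F ⟨FreeAlgebra.lift F g, hrel⟩ (P.gen c) = g c := fun c => by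
    rw [QuadraticPresentation.gen, RingQuot.liftAlgHom_mkAlgHom_apply, FreeAlgebra.lift_ι_apply]
  have h' := congrArg (RingQuot.liftAlgHom F ⟨FreeAlgebra.lift F g, hrel⟩) h
  rw [map_mul, map_mul, hφ, hφ] at h'
  -- The two products of the matrix units have upper left entries `1` and `0`.
  have h'' := congrFun (congrFun h' 0) 0
  simp [g, hne.symm] at h''

theorem nonCommutingGraph_adj (hP : P.rels = {r | ∃ a b, C a b ∧ r = genCommutator F a b})
    {a b : X} : P.nonCommutingGraph.Adj a b ↔ a ≠ b ∧ ¬ C a b ∧ ¬ C b a := by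
  rw [QuadraticPresentation.nonCommutingGraph, SimpleGraph.compl_adj]
  refine and_congr_right fun hne => ?_
  change ¬ (a ≠ b ∧ _) ↔ _
  constructor
  · exact fun h => ⟨fun hc => h ⟨hne, gen_mul_gen_comm hP hc⟩,
      fun hc => h ⟨hne, (gen_mul_gen_comm hP hc).symm⟩⟩
  · exact fun h hc => gen_mul_gen_ne hP hne h.1 h.2 hc.2

end Commutators

/-! ## The monomial ordering -/

section MonomialOrder

variable {X : Type v} {N : ℕ} {f : X → Fin N}

/-- Equal lengths exclude a proper prefix, so the comparison is decided at a letter and survives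
appending. -/
theorem lex_append_of_length_eq {r : X → X → Prop} {u w : List X} (h : List.Lex r u w)
    (hlen : u.length = w.length) (b : List X) : List.Lex r (u ++ b) (w ++ b) := by
  induction h with
  | nil => simp at hlen
  | cons _ ih => exact List.Lex.cons (ih (by simpa using hlen))
  | rel h => exact List.Lex.rel h

theorem isMonomialOrder_degLex (hf : Function.Injective f) : IsMonomialOrder (degLex f) := by
  have htri : Std.Trichotomous fun a b : X => f a < f b :=
    ⟨fun a b h h' => hf (le_antisymm (not_lt.1 h') (not_lt.1 h))⟩
  have hasymm : Std.Asymm fun a b : X => f a < f b := ⟨fun _ _ h h' => lt_asymm h h'⟩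
  have htrans : ∀ u w z : List X, List.Lex (fun a b => f a < f b) u w →
      List.Lex (fun a b => f a < f b) w z → List.Lex (fun a b => f a < f b) u z := by
    intro u w z h h'
    induction h generalizing z with
    | nil => cases h' <;> exact List.Lex.nil
    | cons _ ih =>
      cases h' with
      | cons h' => exact List.Lex.cons (ih _ h')
      | rel h' => exact List.Lex.rel h'
    | rel h =>
      cases h' with
      | cons h' => exact List.Lex.rel h
      | rel h' => exact List.Lex.rel (h.trans h')
  refine ⟨{ trichotomous := ?_, irrefl := ?_, trans := ?_ }, ?_, ?_⟩
  · exact fun u w h h' => FreeMonoid.toList.injective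
      (Std.Trichotomous.trichotomous (r := List.Shortlex fun a b : X => f a < f b) _ _ h h')
  · exact fun u h => Std.Asymm.asymm (r := List.Shortlex fun a b : X => f a < f b) _ _ h h
  · intro u w z h h'
    rw [degLex, List.shortlex_def] at h h' ⊢
    rcases h with h | ⟨h1, h2⟩ <;> rcases h' with h' | ⟨h3, h4⟩
    · exact Or.inl (h.trans h')
    · exact Or.inl (h3 ▸ h)
    · exact Or.inl (h1 ▸ h')
    · exact Or.inr ⟨h1.trans h3, htrans _ _ _ h2 h4⟩
  · exact InvImage.wf FreeMonoid.toList
      (List.Shortlex.wf (InvImage.wf f (wellFounded_lt (α := Fin N))))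
  · intro a b u w h
    simp only [degLex, FreeMonoid.toList_mul, List.append_assoc]
    refine List.Shortlex.append_left ?_ _
    rw [degLex, List.shortlex_def] at h
    rcases h with h | ⟨h1, h2⟩
    · exact List.Shortlex.of_length_lt (by simpa using h)
    · exact List.Shortlex.of_lex (by simpa using h1) (lex_append_of_length_eq h2 h1 _)

theorem degLex_pair_iff {a b : X} (hne : a ≠ b) :
    degLex f (FreeMonoid.of b * FreeMonoid.of a) (FreeMonoid.of a * FreeMonoid.of b) ↔
      f b < f a := by
  rw [degLex, List.shortlex_iff_lex (by simp)]
  simp only [FreeMonoid.toList_mul, FreeMonoid.toList_of, List.singleton_append]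
  constructor
  · intro h
    cases h with
    | cons _ => exact absurd rfl hne
    | rel h => exact h
  · exact fun h => List.Lex.rel h

end MonomialOrder

/-! ## Reductions and ambiguities -/

section Reductions

variable {F : Type u} [Field F] {X : Type v}

theorem repr_wordMonomial (w : FreeMonoid X) :
    (FreeAlgebra.basisFreeMonoid F X).repr (wordMonomial F w) = Finsupp.single w 1 := by
  rw [← basisFreeMonoid_apply, Module.Basis.repr_self]

theorem repr_eq_zero_of_mem_span {s : Set (FreeMonoid X)} {g : FreeAlgebra F X}
    (hg : g ∈ Submodule.span F (wordMonomial F '' s)) {w : FreeMonoid X} (hw : w ∉ s) :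
    (FreeAlgebra.basisFreeMonoid F X).repr g w = 0 := by
  rw [← show ⇑(FreeAlgebra.basisFreeMonoid F X) = wordMonomial F from
    funext (basisFreeMonoid_apply F), Module.Basis.mem_span_image] at hg
  by_contra h
  exact hw (hg (Finsupp.mem_support_iff.2 h))

theorem of_mul_of_injective {a b c d : X}
    (h : FreeMonoid.of a * FreeMonoid.of b = FreeMonoid.of c * FreeMonoid.of d) :
    a = c ∧ b = d := by
  have h' := congrArg FreeMonoid.toList h
  simpa using h'

/-- The only rule given by the relation `ab - ba` with `f b < f a` is `ab ⟶ ba`. -/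
theorem rule_of_genCommutator {N : ℕ} {f : X → Fin N} {a b : X} (hba : f b < f a) {W : FreeMonoid X}
    {g : FreeAlgebra F X} {c : F} (hc : c ≠ 0)
    (h : wordMonomial F W - g = c • genCommutator F a b)
    (hg : g ∈ Submodule.span F (wordMonomial F '' {w | degLex f w W})) :
    W = FreeMonoid.of a * FreeMonoid.of b ∧
      g = wordMonomial F (FreeMonoid.of b * FreeMonoid.of a) := by
  have hne : a ≠ b := fun h => hba.ne (by rw [h])
  have hirr : ∀ w : FreeMonoid X, ¬ degLex f w w := fun w hw => by
    have hasymm : Std.Asymm fun a b : X => f a < f b := ⟨fun _ _ h h' => lt_asymm h h'⟩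
    exact Std.Asymm.asymm (r := List.Shortlex fun a b : X => f a < f b) _ _ hw hw
  have hcom : genCommutator F a b = wordMonomial F (FreeMonoid.of a * FreeMonoid.of b) -
      wordMonomial F (FreeMonoid.of b * FreeMonoid.of a) := by
    simp [genCommutator]
  have hwords : FreeMonoid.of a * FreeMonoid.of b ≠ FreeMonoid.of b * FreeMonoid.of a :=
    fun h => hne (of_mul_of_injective h).1
  have hcoeff : ∀ w, (Finsupp.single W (1 : F)) w -
      (FreeAlgebra.basisFreeMonoid F X).repr g w =
      c * (Finsupp.single (FreeMonoid.of a * FreeMonoid.of b) (1 : F) w -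
        Finsupp.single (FreeMonoid.of b * FreeMonoid.of a) (1 : F) w) := fun w => by
    have h' := DFunLike.congr_fun (congrArg (FreeAlgebra.basisFreeMonoid F X).repr h) w
    simpa only [hcom, map_sub, map_smul, repr_wordMonomial, Finsupp.sub_apply,
      Finsupp.smul_apply, smul_eq_mul] using h'
  -- The left side has coefficient one at `W`, since `g` involves only smaller words; hence `W` is
  -- `ab` or `ba`. If it were `ba`, the larger word `ab` would be absent on the left but have
  -- coefficient `c ≠ 0` on the right.
  have hWab : W = FreeMonoid.of a * FreeMonoid.of b := by
    by_contra hW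
    have h1 := hcoeff W
    rw [repr_eq_zero_of_mem_span hg (hirr W), Finsupp.single_eq_same,
      Finsupp.single_eq_of_ne hW] at h1
    have hW' : W = FreeMonoid.of b * FreeMonoid.of a := by
      by_contra hW'
      rw [Finsupp.single_eq_of_ne hW'] at h1
      simp at h1
    have h2 := hcoeff (FreeMonoid.of a * FreeMonoid.of b)
    have hnlt : ¬ degLex f (FreeMonoid.of a * FreeMonoid.of b) W := by
      rw [hW', degLex_pair_iff hne.symm]
      exact hba.asymm
    rw [repr_eq_zero_of_mem_span hg hnlt, Finsupp.single_eq_same,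
      Finsupp.single_eq_of_ne (Ne.symm hW), Finsupp.single_eq_of_ne hwords] at h2
    simp at h2
    exact hc h2.symm
  refine ⟨hWab, ?_⟩
  have h1 := hcoeff W
  rw [repr_eq_zero_of_mem_span hg (hirr W), hWab, Finsupp.single_eq_same,
    Finsupp.single_eq_of_ne hwords] at h1
  have hc1 : c = 1 := by simpa using h1.symm
  rw [hc1, one_smul, hcom, hWab] at h
  exact sub_right_injective h

theorem mem_reductions_iff {N : ℕ} {f : X → Fin N} {C : X → X → Prop}
    {P : QuadraticPresentation F X}
    (hP : P.rels = {r | ∃ a b, C a b ∧ r = genCommutator F a b})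
    (hC : ∀ a b, C a b → f a ≠ f b) {σ : Rule F X} :
    σ ∈ P.reductions (degLex f) ↔ ∃ a b, ((C a b ∨ C b a) ∧ f b < f a) ∧
      σ = (FreeMonoid.of a * FreeMonoid.of b,
        wordMonomial F (FreeMonoid.of b * FreeMonoid.of a)) := by
  rw [QuadraticPresentation.reductions, hP]
  constructor
  · rintro ⟨_, ⟨a, b, hab, rfl⟩, c, hc, h, hg⟩
    rcases lt_or_gt_of_ne (hC a b hab) with hlt | hlt
    · rw [genCommutator_swap, smul_neg, ← neg_smul] at h
      obtain ⟨h1, h2⟩ := rule_of_genCommutator hlt (neg_ne_zero.2 hc) h hg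
      exact ⟨b, a, ⟨Or.inr hab, hlt⟩, Prod.ext h1 h2⟩
    · obtain ⟨h1, h2⟩ := rule_of_genCommutator hlt hc h hg
      exact ⟨a, b, ⟨Or.inl hab, hlt⟩, Prod.ext h1 h2⟩
  · rintro ⟨a, b, ⟨hab, hlt⟩, rfl⟩
    have hmem : wordMonomial F (FreeMonoid.of b * FreeMonoid.of a) ∈ Submodule.span F
        (wordMonomial F '' {w | degLex f w (FreeMonoid.of a * FreeMonoid.of b)}) :=
      Submodule.subset_span
        ⟨_, (degLex_pair_iff fun h => hlt.ne (by rw [h])).2 hlt, rfl⟩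
    rcases hab with hab | hba
    · exact ⟨_, ⟨a, b, hab, rfl⟩, 1, one_ne_zero, by simp [genCommutator], hmem⟩
    · exact ⟨_, ⟨b, a, hba, rfl⟩, -1, neg_ne_zero.2 one_ne_zero, by simp [genCommutator], hmem⟩

theorem elementaryReduction_self (A : FreeMonoid X) (σ : Rule F X) (B : FreeMonoid X) :
    elementaryReduction A σ B (wordMonomial F (A * σ.1 * B)) =
      wordMonomial F A * σ.2 * wordMonomial F B := by
  rw [elementaryReduction, ← basisFreeMonoid_apply F (A * σ.1 * B), Module.Basis.constr_basis,
    if_pos rfl]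

theorem reducesTo_of_rule {S : Set (Rule F X)} {a b : X}
    (h : (FreeMonoid.of a * FreeMonoid.of b,
      wordMonomial F (FreeMonoid.of b * FreeMonoid.of a)) ∈ S) (A B : FreeMonoid X) :
    ReducesTo S (wordMonomial F (A * (FreeMonoid.of a * FreeMonoid.of b) * B))
      (wordMonomial F (A * (FreeMonoid.of b * FreeMonoid.of a) * B)) := by
  refine Relation.ReflTransGen.single ⟨A, B, _, h, ?_⟩
  rw [elementaryReduction_self _ (FreeMonoid.of a * FreeMonoid.of b, _)]
  simp only [wordMonomial_mul]

theorem eq_of_mul_eq_of_mul_of {A B : FreeMonoid X} {a b : X} (hA : A ≠ 1) (hB : B ≠ 1)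
    (h : FreeMonoid.of a * FreeMonoid.of b = A * B) :
    A = FreeMonoid.of a ∧ B = FreeMonoid.of b := by
  have h' := congrArg FreeMonoid.toList h
  simp only [FreeMonoid.toList_mul, FreeMonoid.toList_of, List.singleton_append] at h'
  have hA' : A.toList ≠ [] := fun h => hA (FreeMonoid.toList.injective h)
  have hB' : B.toList ≠ [] := fun h => hB (FreeMonoid.toList.injective h)
  suffices A.toList = [a] ∧ B.toList = [b] from
    ⟨FreeMonoid.toList.injective this.1, FreeMonoid.toList.injective this.2⟩
  generalize A.toList = s at *
  generalize B.toList = t at *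
  rcases s with _ | ⟨x, s⟩
  · exact absurd rfl hA'
  rcases s with _ | ⟨y, s⟩
  · simp_all
  · simp_all

/-- An overlap `abc` resolves by `bac ⟶ bca ⟶ cba` and `acb ⟶ cab ⟶ cba`, where transitivity
supplies the rule for `ac`. Inclusions do not occur: all left sides have length two, and each
determines its rule. -/
theorem ambiguitiesResolve_of_rules {R : X → X → Prop} (hR : ∀ a b c, R a b → R b c → R a c)
    {S : Set (Rule F X)} (hS : ∀ σ, σ ∈ S ↔ ∃ a b, R a b ∧
      σ = (FreeMonoid.of a * FreeMonoid.of b,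
        wordMonomial F (FreeMonoid.of b * FreeMonoid.of a))) (d : ℕ) :
    AmbiguitiesResolve S d := by
  have hstep : ∀ {a b}, R a b → ∀ A B : FreeMonoid X,
      ReducesTo S (wordMonomial F (A * (FreeMonoid.of a * FreeMonoid.of b) * B))
        (wordMonomial F (A * (FreeMonoid.of b * FreeMonoid.of a) * B)) :=
    fun h => reducesTo_of_rule ((hS _).2 ⟨_, _, h, rfl⟩)
  constructor
  · intro A B C hA hB hC _ σ hσ τ hτ hσAB hτBC
    obtain ⟨a, b, hab, rfl⟩ := (hS σ).1 hσ
    obtain ⟨b', c, hbc, rfl⟩ := (hS τ).1 hτ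
    obtain ⟨rfl, rfl⟩ := eq_of_mul_eq_of_mul_of hA hB hσAB
    obtain ⟨hb, rfl⟩ := eq_of_mul_eq_of_mul_of hB hC hτBC
    obtain rfl := FreeMonoid.of_injective hb
    have hac := hR _ _ _ hab hbc
    refine ⟨wordMonomial F (FreeMonoid.of c * FreeMonoid.of b * FreeMonoid.of a), ?_, ?_⟩
    · have h1 := hstep hac (FreeMonoid.of b) 1
      have h2 := hstep hbc 1 (FreeMonoid.of a)
      simp only [mul_one, one_mul, ← mul_assoc] at h1 h2
      simpa only [ReducesTo, wordMonomial_mul] using h1.trans h2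
    · have h1 := hstep hac 1 (FreeMonoid.of b)
      have h2 := hstep hab (FreeMonoid.of c) 1
      simp only [mul_one, one_mul, ← mul_assoc] at h1 h2
      simpa only [ReducesTo, wordMonomial_mul, mul_assoc] using h1.trans h2
  · intro A B C _ σ hσ τ hτ hne hσB hτ'
    obtain ⟨a, b, hab, rfl⟩ := (hS σ).1 hσ
    obtain ⟨c, d, hcd, rfl⟩ := (hS τ).1 hτ
    have hlen := congrArg FreeMonoid.length hτ'
    simp only at hσB hτ'
    rw [← hσB] at hlen hτ'
    simp only [FreeMonoid.length_mul, FreeMonoid.length_of] at hlen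
    obtain rfl : A = 1 := FreeMonoid.length_eq_zero.1 (by omega)
    obtain rfl : C = 1 := FreeMonoid.length_eq_zero.1 (by omega)
    rw [one_mul, mul_one] at hτ'
    obtain ⟨rfl, rfl⟩ := of_mul_of_injective hτ'
    exact absurd rfl hne

end Reductions

/-- If `a` and `c` did not commute, then `b`, commuting with both and labelled between them, would
violate the ordering condition. -/
theorem descending_trans_of_orderingCondition {F : Type u} [Field F] {X : Type v} {N : ℕ}
    {f : X → Fin N} {C : X → X → Prop} {P : QuadraticPresentation F X}
    (hP : P.rels = {r | ∃ a b, C a b ∧ r = genCommutator F a b})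
    (hord : OrderingCondition P.nonCommutingGraph f) (a b c : X)
    (hab : (C a b ∨ C b a) ∧ f b < f a) (hbc : (C b c ∨ C c b) ∧ f c < f b) :
    (C a c ∨ C c a) ∧ f c < f a := by
  have hca := hbc.2.trans hab.2
  refine ⟨?_, hca⟩
  by_contra h
  rw [not_or] at h
  refine (hord a b c ?_ ?_ ?_).2 ⟨hbc.2, hab.2⟩
  · exact (nonCommutingGraph_adj hP).2 ⟨fun h => hca.ne (by rw [h]), h⟩
  · exact fun h => (not_or.2 ((nonCommutingGraph_adj hP).1 h).2) hab.1
  · exact fun h => (not_or.2 ((nonCommutingGraph_adj hP).1 h).2) hbc.1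

/-! ## The algebra `ch(P_n)` -/

section Path

open PathGen

variable {n : ℕ}

theorem chPair_v_v {i j : Fin n} : ChPair n (v i) (v j) ↔ (i : ℕ) < j := by
  constructor
  · rintro (h | h) <;> omega
  · intro h
    by_cases h' : (j : ℕ) = i + 1
    · exact .vv_succ i j h'
    · exact .vv i j (by omega)

theorem chPair_e_e {i j : Fin (n - 1)} : ChPair n (e i) (e j) ↔ (i : ℕ) + 1 < j := by
  constructor
  · rintro (h | h)
    omega
  · exact .ee i j

theorem chPair_v_e {i : Fin n} {j : Fin (n - 1)} :
    ChPair n (v i) (e j) ↔ (i : ℕ) ≠ j ∧ (i : ℕ) ≠ j + 1 := by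
  constructor
  · rintro (h | h) <;> omega
  · intro h
    by_cases h1 : (j : ℕ) = i + 1
    · exact .ve_right i j h1
    by_cases h2 : (i : ℕ) = j + 2
    · exact .ve_left i j h2
    · exact .ve i j (by omega)

theorem not_chPair_e_v {i : Fin n} {j : Fin (n - 1)} : ¬ ChPair n (e j) (v i) := nofun

theorem not_pathIncident_v_v {i j : Fin n} : ¬ PathIncident n (v i) (v j) := nofun

theorem not_pathIncident_e_v {i : Fin n} {j : Fin (n - 1)} : ¬ PathIncident n (e j) (v i) := nofun

theorem pathIncident_e_e {i j : Fin (n - 1)} :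
    PathIncident n (e i) (e j) ↔ (j : ℕ) = i + 1 := by
  constructor
  · rintro (h | h)
    assumption
  · exact .next i j

theorem pathIncident_v_e {i : Fin n} {j : Fin (n - 1)} :
    PathIncident n (v i) (e j) ↔ (i : ℕ) = j ∨ (i : ℕ) = j + 1 := by
  constructor
  · rintro (h | h) <;> omega
  · rintro (h | h)
    · exact .left i j h
    · exact .right i j h

theorem not_chPair_iff_pathIncident {a b : PathGen n} (hne : a ≠ b) :
    ¬ ChPair n a b ∧ ¬ ChPair n b a ↔ PathIncident n a b ∨ PathIncident n b a := by
  rcases a with i | i <;> rcases b with j | j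
  · have : (i : ℕ) ≠ j := fun h => hne (congrArg _ (Fin.ext h))
    simp only [chPair_v_v, not_pathIncident_v_v, or_false, iff_false]
    omega
  · simp only [chPair_v_e, pathIncident_v_e, not_chPair_e_v, not_pathIncident_e_v,
      not_false_eq_true, and_true, or_false]
    omega
  · simp only [chPair_v_e, pathIncident_v_e, not_chPair_e_v, not_pathIncident_e_v,
      not_false_eq_true, true_and, false_or]
    omega
  · have : (i : ℕ) ≠ j := fun h => hne (congrArg _ (Fin.ext h))
    simp only [chPair_e_e, pathIncident_e_e]
    omega

theorem pathLabel_injective (n : ℕ) : Function.Injective (pathLabel n) := by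
  rintro (i | i) (j | j) h <;> simp only [pathLabel, Fin.mk.injEq] at h
  · exact congrArg _ (Fin.ext (by omega))
  · omega
  · omega
  · exact congrArg _ (Fin.ext (by omega))

theorem isVertexOrdering_pathLabel (n : ℕ) : IsVertexOrdering (pathLabel n) := by
  have hcard : Fintype.card (PathGen n) = 2 * n - 1 := by
    simp only [Fintype.card_sum, Fintype.card_fin]
    -- For `n = 0` truncated subtraction makes both sides zero.
    omega
  refine ⟨hcard, ((Fintype.bijective_iff_injective_and_card _).2
    ⟨pathLabel_injective n, by rw [hcard, Fintype.card_fin]⟩).2⟩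

theorem chPair_ne {a b : PathGen n} (h : ChPair n a b) : a ≠ b := by
  rintro rfl
  rcases a with i | i
  · exact absurd (chPair_v_v.1 h) (lt_irrefl _)
  · exact absurd (chPair_e_e.1 h) (by omega)

theorem nonCommutingGraph_chP (F : Type u) [Field F] (n : ℕ) :
    (chP F n).nonCommutingGraph = pathNonCommutingGraph n := by
  ext a b
  rw [nonCommutingGraph_adj (C := ChPair n) rfl, pathNonCommutingGraph, SimpleGraph.fromRel_adj]
  exact and_congr_right not_chPair_iff_pathIncident

/-- Labels of joined generators differ by one, or by two for consecutive edges. In the latter case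
the only label in between is that of their common vertex, which is joined to both. -/
theorem orderingCondition_pathLabel (n : ℕ) :
    OrderingCondition (pathNonCommutingGraph n) (pathLabel n) := by
  intro a b c hac hab hbc
  simp only [pathNonCommutingGraph, SimpleGraph.fromRel_adj, not_and] at hac hab hbc
  rcases a with i | i <;> rcases b with j | j <;> rcases c with k | k <;>
    simp only [ne_eq, not_pathIncident_v_v, not_pathIncident_e_v, pathIncident_e_e,
      pathIncident_v_e, pathLabel, Fin.lt_def, Sum.inl.injEq, Sum.inr.injEq, reduceCtorEq,
      Fin.ext_iff, or_false, false_or, and_false, not_false_eq_true, true_and, forall_const,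
      not_or] at hac hab hbc ⊢ <;> omega

end Path

theorem mainTheorem6 (F : Type*) [Field F] (n : ℕ) :
    (chP F n).IsPGC ∧
    (chP F n).nonCommutingGraph = pathNonCommutingGraph n ∧
    IsVertexOrdering (pathLabel n) ∧
    OrderingCondition (chP F n).nonCommutingGraph (pathLabel n) ∧
    IsMonomialOrder (degLex (pathLabel n)) ∧
    (∀ d : ℕ, AmbiguitiesResolve ((chP F n).reductions (degLex (pathLabel n))) d) ∧
    (chP F n).IsKoszul := by
  have hrels : (chP F n).rels = {r | ∃ a b, ChPair n a b ∧ r = genCommutator F a b} := rfl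
  have hlabel : ∀ a b, ChPair n a b → pathLabel n a ≠ pathLabel n b := fun a b h =>
    (pathLabel_injective n).ne (chPair_ne h)
  have hord : OrderingCondition (chP F n).nonCommutingGraph (pathLabel n) :=
    nonCommutingGraph_chP F n ▸ orderingCondition_pathLabel n
  have htrans := descending_trans_of_orderingCondition hrels hord
  refine ⟨?_, nonCommutingGraph_chP F n, isVertexOrdering_pathLabel n, hord,
    isMonomialOrder_degLex (pathLabel_injective n),
    ambiguitiesResolve_of_rules htrans fun _ => mem_reductions_iff hrels hlabel,
    QuadraticPresentation.isKoszul_of_relSpan_eq (pathLabel_injective n) htrans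
      (fun _ _ h => h.2) (relSpan_eq_span_descending hrels hlabel)⟩
  rintro r ⟨a, b, -, rfl⟩
  exact ⟨a, b, rfl⟩
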